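/- Let $d\ge 0$ be an integer and $m>0$. For a linear map $\delta:V\to W$ of complex vector spaces, viewed as a complex with $V$ in degree $-1$ and $W$ in degree $0$, let $\mathrm{Sym}(V\xrightarrow{\delta}W)$ be the graded symmetric algebra, with degree $-k$ part $\mathrm{Sym}(W)\otimes\bigwedge^kV$ and with differential the graded derivation that extends $\delta$ and vanishes on $W$; thus $H^0$ is the quotient of $\mathrm{Sym}(W)$ by the image of the degree $-1$ part. For $U\subseteq\mathbb R^d$ open put $$\mathrm{Obs}^{\rm cl}(U)=\mathrm{Sym}\bigl(C_c^\infty(U,\mathbb C)\xrightarrow{-(-\Delta+m^2)}C_c^\infty(U,\mathbb C)\bigr),$$ and define $\mathrm{Obs}^{\rm cl}(T_L^d)$ in the same way from $C^\infty(T^d_L,\mathbb C)$, where $T^d_L=(\mathbb R/L\mathbb Z)^d$. The natural augmentation state $\langle-\rangle_{\rm aug}:H^0\mathrm{Obs}^{\rm cl}(\mathbb R^d)\to\mathbb C$ sends the class of $c+f+f_1*f_2+\cdots$ to its constant term $c$. It is evaluated on $H^0\mathrm{Obs}^{\rm cl}(U)$ through the map $H^0\mathrm{Obs}^{\rm cl}(U)\to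 H^0\mathrm{Obs}^{\rm cl}(\mathbb R^d)$ induced by extension by zero. Theorem. Let $U\subset\mathbb R^d$ be a bounded open set. For all sufficiently large $L$ the projection $\mathbb R^d\to T^d_L$ is injective on $U$. For every $L>0$ for which it is injective on $U$, let $i:H^0\mathrm{Obs}^{\rm cl}(U)\to H^0\mathrm{Obs}^{\rm cl}(T^d_L)$ be the map induced by extension by zero from $U\subset T^d_L$. Then the map $\mathbb C\to H^0\mathrm{Obs}^{\rm cl}(T^d_L)$, $c\mapsto[c]$, is bijective, so that $H^0\mathrm{Obs}^{\rm cl}(T^d_L)=\mathbb C$, and the compactification state $$\langle-\rangle_{\rm cptf}:H^0\mathrm{Obs}^{\rm cl}(U)\xrightarrow{\ i\ }H^0\mathrm{Obs}^{\rm cl}(T^d_L)=\mathbb C$$ satisfies $$\langle-\rangle_{\rm cptf}=\langle-\rangle_{\rm aug}\quad\text{on } H^0\mathrm{Obs}^{\rm cl}(U).$$ -/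

import Mathlib

open scoped ContDiff TensorProduct Distributions
open TopologicalSpace

/-! ## The symmetric algebra of a two-term complex

For a linear map `δ : V → W`, regarded as a cochain complex with `V` in degree `-1` and `W` in
degree `0`, the graded symmetric algebra `Sym (V → W)` has degree `-k` part `Sym W ⊗ ⋀^k V`. -/

namespace BVSym

variable {V W V' W' : Type} [AddCommGroup V] [Module ℂ V] [AddCommGroup W] [Module ℂ W]
  [AddCommGroup V'] [Module ℂ V'] [AddCommGroup W'] [Module ℂ W']

/-- The degree `-k` part `Sym W * ⋀^k V` of the graded symmetric algebra on `V` (in degree `-1`)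
and `W` (in degree `0`). -/
abbrev Obs (V W : Type) [AddCommGroup V] [Module ℂ V] [AddCommGroup W] [Module ℂ W] (k : ℕ) :
    Type :=
  SymmetricAlgebra ℂ W ⊗[ℂ] (⋀[ℂ]^k V)

/-- The map `v ↦ ((v₁, …, v_k) ↦ δ v * (v₁ ∧ ⋯ ∧ v_k))`. -/
noncomputable def diffAux (δ : V →ₗ[ℂ] W) (k : ℕ) : V →ₗ[ℂ] V [⋀^Fin k]→ₗ[ℂ] Obs V W k where
  toFun v := (TensorProduct.mk ℂ (SymmetricAlgebra ℂ W) (⋀[ℂ]^k V)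
    (SymmetricAlgebra.ι ℂ W (δ v))).compAlternatingMap (exteriorPower.ιMulti ℂ k)
  map_add' v w := by
    ext x
    simp
  map_smul' c v := by
    ext x
    simp [TensorProduct.smul_tmul']

/-- The differential `Sym(V → W)^{-(k+1)} → Sym(V → W)^{-k}`: the graded derivation extending `δ`
and vanishing on `W`. See `diff_tmul` for the explicit formula. -/
noncomputable def diff (δ : V →ₗ[ℂ] W) (k : ℕ) : Obs V W (k + 1) →ₗ[ℂ] Obs V W k :=
  TensorProduct.lift
    ((LinearMap.rTensorHom (⋀[ℂ]^k V) ∘ₗ LinearMap.mul ℂ (SymmetricAlgebra ℂ W)).compl₂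
      (exteriorPower.alternatingMapLinearEquiv
        (AlternatingMap.alternatizeUncurryFin (diffAux δ k))))

/-- `d (P * v₀ ∧ ⋯ ∧ v_k) = ∑ᵢ (-1)^i (P * δ vᵢ) * (v₀ ∧ ⋯ omit vᵢ ⋯ ∧ v_k)`. -/
theorem diff_tmul (δ : V →ₗ[ℂ] W) (k : ℕ) (v : Fin (k + 1) → V) (P : SymmetricAlgebra ℂ W) :
    diff δ k (P ⊗ₜ[ℂ] exteriorPower.ιMulti ℂ (k + 1) v) =
      ∑ i : Fin (k + 1), (-1 : ℤ) ^ (i : ℕ) •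
        ((P * SymmetricAlgebra.ι ℂ W (δ (v i))) ⊗ₜ[ℂ]
          exteriorPower.ιMulti ℂ k (i.removeNth v)) := by
  simp [diff, AlternatingMap.alternatizeUncurryFin_apply, diffAux, map_sum]

/-- Two linear maps out of `Sym W * ⋀^k V` agree if they agree on the products
`P * v₁ ∧ ⋯ ∧ v_k`. -/
theorem hom_ext {k : ℕ} {M : Type} [AddCommGroup M] [Module ℂ M] {f g : Obs V W k →ₗ[ℂ] M}
    (h : ∀ (v : Fin k → V) (P : SymmetricAlgebra ℂ W),
      f (P ⊗ₜ[ℂ] exteriorPower.ιMulti ℂ k v) = g (P ⊗ₜ[ℂ] exteriorPower.ιMulti ℂ k v)) :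
    f = g := by
  apply TensorProduct.ext
  ext P v
  exact h v P

/-- The differential squares to zero. -/
theorem diff_comp_diff (δ : V →ₗ[ℂ] W) (k : ℕ) : diff δ k ∘ₗ diff δ (k + 1) = 0 := by
  apply hom_ext
  intro v P
  let F : V →ₗ[ℂ] V →ₗ[ℂ] V [⋀^Fin k]→ₗ[ℂ] Obs V W k :=
    LinearMap.mk₂ ℂ (fun x y => (TensorProduct.mk ℂ (SymmetricAlgebra ℂ W) (⋀[ℂ]^k V)
      (P * SymmetricAlgebra.ι ℂ W (δ x) * SymmetricAlgebra.ι ℂ W (δ y))).compAlternatingMap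
        (exteriorPower.ιMulti ℂ k))
      (fun x y z => by ext w; simp [mul_add, add_mul])
      (fun c x y => by ext w; simp [TensorProduct.smul_tmul'])
      (fun x y z => by ext w; simp [mul_add])
      (fun c x y => by ext w; simp [TensorProduct.smul_tmul'])
  have hF : ∀ x y, F x y = F y x := by
    intro x y
    ext w
    simp only [F, LinearMap.mk₂_apply]
    rw [mul_right_comm]
  have h := AlternatingMap.alternatizeUncurryFin_alternatizeUncurryFinLM_comp_of_symmetric hF
  have h2 := congrArg (fun a => a v) h
  simp only [AlternatingMap.alternatizeUncurryFin_apply, LinearMap.coe_comp,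
    Function.comp_apply, AlternatingMap.alternatizeUncurryFinLM_apply,
    AlternatingMap.zero_apply] at h2
  simp only [LinearMap.comp_apply, diff_tmul, map_sum, map_zsmul, LinearMap.zero_apply]
  exact h2

/-- The degree-zero cohomology
`H⁰ (Sym (V → W)) = Sym (V → W)⁰ / d (Sym (V → W)⁻¹)`. -/
abbrev H0 (δ : V →ₗ[ℂ] W) : Type := Obs V W 0 ⧸ LinearMap.range (diff δ 0)

/-- The inclusion of the constants `ℂ → Sym (V → W)⁰`. -/
noncomputable def const (V W : Type) [AddCommGroup V] [Module ℂ V] [AddCommGroup W] [Module ℂ W] :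
    ℂ →ₗ[ℂ] Obs V W 0 :=
  (TensorProduct.mk ℂ (SymmetricAlgebra ℂ W) (⋀[ℂ]^0 V)).flip
      ((exteriorPower.zeroEquiv ℂ V).symm 1) ∘ₗ
    Algebra.linearMap ℂ (SymmetricAlgebra ℂ W)

/-- The map `ℂ → H⁰ (Sym (V → W))`, `c ↦ [c]`. -/
noncomputable def unitH0 (δ : V →ₗ[ℂ] W) : ℂ →ₗ[ℂ] H0 δ :=
  (LinearMap.range (diff δ 0)).mkQ ∘ₗ const V W

/-- The augmentation `Sym (V → W)⁰ → ℂ`, `c + f + f₁ * f₂ + ⋯ ↦ c`. -/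
noncomputable def aug (V W : Type) [AddCommGroup V] [Module ℂ V] [AddCommGroup W] [Module ℂ W] :
    Obs V W 0 →ₗ[ℂ] ℂ :=
  (TensorProduct.lid ℂ ℂ).toLinearMap ∘ₗ
    TensorProduct.map (SymmetricAlgebra.algebraMapInv (R := ℂ) (M := W)).toLinearMap
      (exteriorPower.zeroEquiv ℂ V).toLinearMap

theorem aug_const (c : ℂ) : aug V W (const V W c) = c := by
  simp [aug, const, (SymmetricAlgebra.algebraMap_leftInverse (R := ℂ) W) c]

theorem aug_comp_diff (δ : V →ₗ[ℂ] W) : aug V W ∘ₗ diff δ 0 = 0 := by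
  apply hom_ext
  intro v P
  simp only [LinearMap.comp_apply, diff_tmul, map_sum, map_zsmul, LinearMap.zero_apply]
  simp [aug, SymmetricAlgebra.algebraMapInv_ι]

/-- The map `H⁰ (Sym (V → W)) → ℂ` induced by the augmentation. -/
noncomputable def augH0 (δ : V →ₗ[ℂ] W) : H0 δ →ₗ[ℂ] ℂ :=
  (LinearMap.range (diff δ 0)).liftQ (aug V W)
    (LinearMap.range_le_ker_iff.mpr (aug_comp_diff δ))

/-- The algebra map on `Sym W` induced by a linear map. -/
noncomputable def symMap (g : W →ₗ[ℂ] W') : SymmetricAlgebra ℂ W →ₐ[ℂ] SymmetricAlgebra ℂ W' :=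
  SymmetricAlgebra.lift (SymmetricAlgebra.ι ℂ W' ∘ₗ g)

/-- The map on graded symmetric algebras induced by linear maps in degrees `-1` and `0`. -/
noncomputable def map (f : V →ₗ[ℂ] V') (g : W →ₗ[ℂ] W') (k : ℕ) :
    Obs V W k →ₗ[ℂ] Obs V' W' k :=
  TensorProduct.map (symMap g).toLinearMap (exteriorPower.map k f)

/-- A morphism of two-term complexes induces a cochain map of symmetric algebras. -/
theorem diff_comp_map {δ : V →ₗ[ℂ] W} {δ' : V' →ₗ[ℂ] W'} {f : V →ₗ[ℂ] V'} {g : W →ₗ[ℂ] W'}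
    (h : δ' ∘ₗ f = g ∘ₗ δ) (k : ℕ) :
    diff δ' k ∘ₗ map f g (k + 1) = map f g k ∘ₗ diff δ k := by
  apply hom_ext
  intro v P
  have h' : ∀ x, δ' (f x) = g (δ x) := fun x => LinearMap.congr_fun h x
  simp only [LinearMap.comp_apply, diff_tmul, map_sum, map_zsmul, map, TensorProduct.map_tmul,
    exteriorPower.map_apply_ιMulti, AlgHom.toLinearMap_apply, map_mul]
  refine Finset.sum_congr rfl fun i _ => ?_
  simp only [Function.comp_apply, h', symMap, SymmetricAlgebra.lift_ι_apply, LinearMap.comp_apply]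
  rfl

/-- The map on `H⁰` induced by a morphism of two-term complexes. -/
noncomputable def mapH0 {δ : V →ₗ[ℂ] W} {δ' : V' →ₗ[ℂ] W'} (f : V →ₗ[ℂ] V') (g : W →ₗ[ℂ] W')
    (h : δ' ∘ₗ f = g ∘ₗ δ) : H0 δ →ₗ[ℂ] H0 δ' :=
  (LinearMap.range (diff δ 0)).mapQ (LinearMap.range (diff δ' 0)) (map f g 0) (by
    rintro _ ⟨x, rfl⟩
    exact ⟨map f g 1 x, LinearMap.congr_fun (diff_comp_map h 0) x⟩)

end BVSym

/-! ## The massive free scalar on open subsets of `ℝ^d` and on the torus -/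

namespace FreeScalar

open InnerProductSpace Laplacian

/-- Euclidean space `ℝ^d`. -/
abbrev E (d : ℕ) : Type := EuclideanSpace ℝ (Fin d)

variable {d : ℕ}

/-- The function `-(-Δ + m²) f` on `ℝ^d`. -/
noncomputable def eom (m : ℝ) (f : E d → ℂ) : E d → ℂ :=
  fun x => -(-(Δ f x) + (m : ℂ) ^ 2 * f x)

theorem eom_add (m : ℝ) {f g : E d → ℂ} (hf : ContDiff ℝ ∞ f) (hg : ContDiff ℝ ∞ g) :
    eom m (f + g) = eom m f + eom m g := by
  funext x
  have h := ContDiffAt.laplacian_add (x := x) (contDiff_infty.1 hf 2).contDiffAt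
    (contDiff_infty.1 hg 2).contDiffAt
  simp only [eom, h, Pi.add_apply]
  ring

theorem eom_smul (m : ℝ) (c : ℂ) {f : E d → ℂ} (hf : ContDiff ℝ ∞ f) :
    eom m (c • f) = c • eom m f := by
  funext x
  have h := laplacian_smul (x := x) c (contDiff_infty.1 hf 2).contDiffAt
  simp only [eom, h, Pi.smul_apply, smul_eq_mul]
  ring

theorem contDiff_eom (m : ℝ) {f : E d → ℂ} (hf : ContDiff ℝ ∞ f) : ContDiff ℝ ∞ (eom m f) := by
  have hΔ : ContDiff ℝ ∞ (Δ f) := by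
    rw [laplacian_eq_iteratedFDeriv_stdOrthonormalBasis]
    refine ContDiff.sum fun i _ => ?_
    have h := hf.iteratedFDeriv_right (i := 2) (m := ∞) le_rfl
    exact (ContinuousMultilinearMap.apply ℝ (fun _ : Fin 2 => E d) ℂ _).contDiff.comp h
  exact (hΔ.neg.add (contDiff_const.mul hf)).neg

theorem eom_congr (m : ℝ) {f g : E d → ℂ} {x : E d} (h : f =ᶠ[nhds x] g) :
    eom m f x = eom m g x := by
  simp only [eom, h.eq_of_nhds, (laplacian_congr_nhds h).eq_of_nhds]

theorem eom_zero (m : ℝ) : eom m (0 : E d → ℂ) = 0 := by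
  have h := eom_smul m 0 (f := (0 : E d → ℂ)) contDiff_const
  simpa using h

theorem eom_comp_add_left (m : ℝ) (f : E d → ℂ) (a x : E d) :
    eom m (fun v => f (a + v)) x = eom m f (a + x) := by
  simp only [eom, laplacian_eq_iteratedFDeriv_stdOrthonormalBasis, iteratedFDeriv_comp_add_left]

theorem tsupport_eom_subset (m : ℝ) (f : E d → ℂ) : tsupport (eom m f) ⊆ tsupport f := by
  refine closure_minimal (fun x hx => ?_) (isClosed_tsupport f)
  by_contra hn
  apply hx
  have h : f =ᶠ[nhds x] 0 := notMem_tsupport_iff_eventuallyEq.mp hn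
  rw [eom_congr m h, eom_zero]
  rfl

/-- The classical Batalin–Vilkovisky operator `f⋆ ↦ -(-Δ + m²) f` on `C_c^∞(U, ℂ)`. -/
noncomputable def bv (m : ℝ) (U : Opens (E d)) : 𝓓(U, ℂ) →ₗ[ℂ] 𝓓(U, ℂ) where
  toFun f :=
    { toFun := eom m f
      contDiff' := contDiff_eom m f.contDiff
      hasCompactSupport' :=
        f.hasCompactSupport.of_isClosed_subset (isClosed_tsupport _) (tsupport_eom_subset m f)
      tsupport_subset' := (tsupport_eom_subset m f).trans f.tsupport_subset }
  map_add' f g := by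
    ext x
    exact congrFun (eom_add m f.contDiff g.contDiff) x
  map_smul' c f := by
    ext x
    exact congrFun (eom_smul m c f.contDiff) x

/-- Extension by zero `C_c^∞(U, ℂ) → C_c^∞(ℝ^d, ℂ)`. A test function on `U` is already stored as a
function on `ℝ^d` with compact support contained in `U`. -/
noncomputable def extendZero (U : Opens (E d)) : 𝓓(U, ℂ) →ₗ[ℂ] 𝓓((⊤ : Opens (E d)), ℂ) where
  toFun f :=
    { toFun := f
      contDiff' := f.contDiff
      hasCompactSupport' := f.hasCompactSupport
      tsupport_subset' := fun _ _ => trivial }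
  map_add' _ _ := rfl
  map_smul' _ _ := rfl

theorem bv_extendZero (m : ℝ) (U : Opens (E d)) :
    bv m ⊤ ∘ₗ extendZero U = extendZero U ∘ₗ bv m U := rfl

/-- The torus `T^d = (ℝ / Lℤ)^d` of circumference `L`. -/
abbrev Torus (d : ℕ) (L : ℝ) : Type := Fin d → AddCircle L

/-- The covering map `ℝ^d → T^d`. -/
def proj (d : ℕ) (L : ℝ) (x : E d) : Torus d L := fun i => (x i : AddCircle L)

theorem continuous_proj (L : ℝ) : Continuous (proj d L) := by
  refine continuous_pi fun i => ?_
  exact (AddCircle.continuous_mk' L).comp (by fun_prop)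

theorem proj_add (L : ℝ) (x y : E d) : proj d L (x + y) = proj d L x + proj d L y := by
  funext i
  simp [proj]

theorem proj_sub (L : ℝ) (x y : E d) : proj d L (x - y) = proj d L x - proj d L y := by
  funext i
  simp [proj]

theorem proj_surjective (L : ℝ) : Function.Surjective (proj d L) := by
  intro y
  choose x hx using fun i => QuotientAddGroup.mk_surjective (y i)
  exact ⟨WithLp.toLp 2 x, funext hx⟩

/-- `C^∞(T^d, ℂ)`: functions on the torus whose pullback to `ℝ^d` along the covering map is
smooth. As the torus is compact, this is also `C_c^∞(T^d, ℂ)`. -/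
def SmoothTorus (d : ℕ) (L : ℝ) : Submodule ℂ (Torus d L → ℂ) where
  carrier := {g | ContDiff ℝ ∞ (g ∘ proj d L)}
  add_mem' {f g} hf hg := by
    change ContDiff ℝ ∞ (f ∘ proj d L + g ∘ proj d L)
    exact ContDiff.add hf hg
  zero_mem' := by
    change ContDiff ℝ ∞ (fun _ : E d => (0 : ℂ))
    exact contDiff_const
  smul_mem' c f hf := by
    change ContDiff ℝ ∞ (c • (f ∘ proj d L))
    exact ContDiff.const_smul c hf

/-- The function `-(-Δ + m²) g` on the torus, computed in the local coordinate
`v ↦ y + proj v` at each point `y`. -/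
noncomputable def eomTorus {L : ℝ} (m : ℝ) (g : Torus d L → ℂ) : Torus d L → ℂ :=
  fun y => eom m (fun v : E d => g (y + proj d L v)) 0

theorem eomTorus_proj {L : ℝ} (m : ℝ) (g : Torus d L → ℂ) (x : E d) :
    eomTorus m g (proj d L x) = eom m (g ∘ proj d L) x := by
  have h := eom_comp_add_left m (g ∘ proj d L) x 0
  rw [add_zero] at h
  rw [← h]
  simp only [Function.comp_apply, eomTorus, proj_add]

theorem eomTorus_comp_proj {L : ℝ} (m : ℝ) (g : Torus d L → ℂ) :
    eomTorus m g ∘ proj d L = eom m (g ∘ proj d L) :=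
  funext fun x => eomTorus_proj m g x

theorem eomTorus_add {L : ℝ} (m : ℝ) {f g : Torus d L → ℂ}
    (hf : ContDiff ℝ ∞ (f ∘ proj d L)) (hg : ContDiff ℝ ∞ (g ∘ proj d L)) :
    eomTorus m (f + g) = eomTorus m f + eomTorus m g := by
  funext y
  obtain ⟨x, rfl⟩ := proj_surjective L y
  have h : (f + g) ∘ proj d L = f ∘ proj d L + g ∘ proj d L := rfl
  rw [Pi.add_apply, eomTorus_proj, eomTorus_proj, eomTorus_proj, h, eom_add m hf hg, Pi.add_apply]

theorem eomTorus_smul {L : ℝ} (m : ℝ) (c : ℂ) {f : Torus d L → ℂ}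
    (hf : ContDiff ℝ ∞ (f ∘ proj d L)) : eomTorus m (c • f) = c • eomTorus m f := by
  funext y
  obtain ⟨x, rfl⟩ := proj_surjective L y
  have h : (c • f) ∘ proj d L = c • (f ∘ proj d L) := rfl
  rw [Pi.smul_apply, eomTorus_proj, eomTorus_proj, h, eom_smul m c hf, Pi.smul_apply]

theorem eomTorus_mem {L : ℝ} (m : ℝ) {g : Torus d L → ℂ} (hg : g ∈ SmoothTorus d L) :
    eomTorus m g ∈ SmoothTorus d L := by
  have h : ContDiff ℝ ∞ (eom m (g ∘ proj d L)) := contDiff_eom m hg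
  rw [← eomTorus_comp_proj] at h
  exact h

/-- The classical Batalin–Vilkovisky operator `f⋆ ↦ -(-Δ + m²) f` on `C^∞(T^d, ℂ)`. -/
noncomputable def bvTorus (m : ℝ) (d : ℕ) (L : ℝ) : SmoothTorus d L →ₗ[ℂ] SmoothTorus d L where
  toFun g := ⟨eomTorus m g.1, eomTorus_mem m g.2⟩
  map_add' f g := Subtype.ext (eomTorus_add m f.2 g.2)
  map_smul' c f := Subtype.ext (eomTorus_smul m c f.2)

/-- The extension by zero to `T^d` of a function on `U`, where `U` is regarded as a subset of `T^d`
through the covering map (which is injective on `U` in all uses). -/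
noncomputable def pushTorus (L : ℝ) (U : Opens (E d)) (f : E d → ℂ) : Torus d L → ℂ :=
  Function.extend (fun u : U => proj d L u) (fun u : U => f u) 0

section

variable {L : ℝ} {U : Opens (E d)}

theorem pushTorus_proj (hU : Set.InjOn (proj d L) U) (f : E d → ℂ) {u : E d} (hu : u ∈ U) :
    pushTorus L U f (proj d L u) = f u :=
  Function.Injective.extend_apply (f := fun u : U => proj d L u)
    (fun a b h => Subtype.ext (hU a.2 b.2 h)) (fun u : U => f u) 0 ⟨u, hu⟩

theorem pushTorus_eq_zero (hU : Set.InjOn (proj d L) U) (f : E d → ℂ) {y : Torus d L}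
    (hy : y ∉ proj d L '' tsupport f) : pushTorus L U f y = 0 := by
  by_cases h : ∃ u : U, proj d L u = y
  · obtain ⟨u, rfl⟩ := h
    rw [pushTorus_proj hU f u.2]
    by_contra hne
    exact hy ⟨u, subset_tsupport f hne, rfl⟩
  · exact Function.extend_apply' _ _ _ h

/-- Near a point `x` of `ℝ^d`, the pullback of the extension by zero of `f` is either a translate
of `f` or zero. -/
theorem pushTorus_local (f : 𝓓(U, ℂ)) (x : E d) :
    (∃ a : E d, proj d L (a + x) = proj d L x ∧ a + x ∈ U ∧
      ∀ᶠ v in nhds x, a + v ∈ U ∧ proj d L (a + v) = proj d L v) ∨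
    (proj d L x ∉ proj d L '' tsupport f ∧
      ∀ᶠ v in nhds x, proj d L v ∉ proj d L '' tsupport f) := by
  by_cases h : proj d L x ∈ proj d L '' tsupport f
  · left
    obtain ⟨u, hu, hux⟩ := h
    refine ⟨u - x, by simpa using hux, by simpa using f.tsupport_subset hu, ?_⟩
    have hc : Continuous fun v : E d => u - x + v := by fun_prop
    have ho : IsOpen ((fun v : E d => u - x + v) ⁻¹' U) := U.isOpen.preimage hc
    filter_upwards [ho.mem_nhds (by simpa using f.tsupport_subset hu)] with v hv
    exact ⟨hv, by rw [proj_add, proj_sub, hux]; simp⟩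
  · right
    refine ⟨h, ?_⟩
    have hK : IsCompact (proj d L '' tsupport f) :=
      f.hasCompactSupport.isCompact.image (continuous_proj L)
    exact (hK.isClosed.isOpen_compl.preimage (continuous_proj L)).mem_nhds h

theorem contDiff_pushTorus (hU : Set.InjOn (proj d L) U) (f : 𝓓(U, ℂ)) :
    ContDiff ℝ ∞ (pushTorus L U f ∘ proj d L) := by
  rw [contDiff_iff_contDiffAt]
  intro x
  rcases pushTorus_local f x with ⟨a, -, -, ha⟩ | ⟨-, hx⟩
  · have h1 : ContDiff ℝ ∞ fun v : E d => f (a + v) := f.contDiff.comp (by fun_prop)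
    refine h1.contDiffAt.congr_of_eventuallyEq ?_
    filter_upwards [ha] with v hv
    rw [Function.comp_apply, ← hv.2, pushTorus_proj hU f hv.1]
  · refine (contDiff_const (c := (0 : ℂ))).contDiffAt.congr_of_eventuallyEq ?_
    filter_upwards [hx] with v hv
    exact pushTorus_eq_zero hU f hv

/-- The inclusion `C_c^∞(U, ℂ) → C^∞(T^d, ℂ)` for `U` embedded in `T^d`. -/
noncomputable def toTorus (hU : Set.InjOn (proj d L) U) : 𝓓(U, ℂ) →ₗ[ℂ] SmoothTorus d L where
  toFun f := ⟨pushTorus L U f, contDiff_pushTorus hU f⟩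
  map_add' f g := by
    apply Subtype.ext
    funext y
    by_cases h : ∃ u : U, proj d L u = y
    · obtain ⟨u, rfl⟩ := h
      simp [pushTorus_proj hU _ u.2]
    · simp [pushTorus, Function.extend_apply' _ _ _ h]
  map_smul' c f := by
    apply Subtype.ext
    funext y
    by_cases h : ∃ u : U, proj d L u = y
    · obtain ⟨u, rfl⟩ := h
      simp [pushTorus_proj hU _ u.2]
    · simp [pushTorus, Function.extend_apply' _ _ _ h]

/-- The inclusion is compatible with the Batalin–Vilkovisky operators. -/
theorem bvTorus_toTorus (m : ℝ) (hU : Set.InjOn (proj d L) U) :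
    bvTorus m d L ∘ₗ toTorus hU = toTorus hU ∘ₗ bv m U := by
  ext f : 1
  apply Subtype.ext
  funext y
  obtain ⟨x, rfl⟩ := proj_surjective L y
  change eomTorus m (pushTorus L U f) (proj d L x) = pushTorus L U (eom m f) (proj d L x)
  rw [eomTorus_proj]
  rcases pushTorus_local f x with ⟨a, hax, haU, ha⟩ | ⟨hx0, hx⟩
  · have h1 : pushTorus L U f ∘ proj d L =ᶠ[nhds x] fun v : E d => f (a + v) := by
      filter_upwards [ha] with v hv
      rw [Function.comp_apply, ← hv.2, pushTorus_proj hU f hv.1]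
    rw [eom_congr m h1, eom_comp_add_left, ← hax, pushTorus_proj hU _ haU]
  · have h1 : pushTorus L U f ∘ proj d L =ᶠ[nhds x] 0 := by
      filter_upwards [hx] with v hv
      exact pushTorus_eq_zero hU f hv
    rw [eom_congr m h1, eom_zero, pushTorus_eq_zero hU]
    · rfl
    · exact fun h => hx0 (Set.image_mono (tsupport_eom_subset m f) h)

end

/-! ## Cohomology and states -/

/-- `H⁰ Obs^cl(U)` for an open subset `U` of `ℝ^d`. -/
abbrev H0Obs (m : ℝ) (U : Opens (E d)) : Type := BVSym.H0 (bv m U)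

/-- `H⁰ Obs^cl(T^d)`. -/
abbrev H0ObsTorus (m : ℝ) (d : ℕ) (L : ℝ) : Type := BVSym.H0 (bvTorus m d L)

/-- The map `H⁰ Obs^cl(U) → H⁰ Obs^cl(ℝ^d)` induced by extension by zero. -/
noncomputable def extendH0 (m : ℝ) (U : Opens (E d)) :
    H0Obs m U →ₗ[ℂ] H0Obs m (⊤ : Opens (E d)) :=
  BVSym.mapH0 (extendZero U) (extendZero U) (bv_extendZero m U)

/-- The map `i : H⁰ Obs^cl(U) → H⁰ Obs^cl(T^d)` for `U` embedded in `T^d`. -/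
noncomputable def toTorusH0 (m : ℝ) {L : ℝ} {U : Opens (E d)} (hU : Set.InjOn (proj d L) U) :
    H0Obs m U →ₗ[ℂ] H0ObsTorus m d L :=
  BVSym.mapH0 (toTorus hU) (toTorus hU) (bvTorus_toTorus m hU)

/-- The natural augmentation state `⟨-⟩_aug : H⁰ Obs^cl(ℝ^d) → ℂ`,
`[c + f + f₁ * f₂ + ⋯] ↦ c`. -/
noncomputable def augState (m : ℝ) (d : ℕ) : H0Obs m (⊤ : Opens (E d)) →ₗ[ℂ] ℂ :=
  BVSym.augH0 (bv m ⊤)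

/-- The compactification state `⟨-⟩_cptf : H⁰ Obs^cl(U) → H⁰ Obs^cl(T^d) = ℂ`. The identification
`H⁰ Obs^cl(T^d) = ℂ` is the inverse of `c ↦ [c]`, once this map is known to be bijective. -/
noncomputable def cptfState (m : ℝ) {L : ℝ} {U : Opens (E d)} (hU : Set.InjOn (proj d L) U)
    (hT : Function.Bijective (BVSym.unitH0 (bvTorus m d L))) : H0Obs m U →ₗ[ℂ] ℂ :=
  (LinearEquiv.ofBijective (BVSym.unitH0 (bvTorus m d L)) hT).symm.toLinearMap ∘ₗ toTorusH0 m hU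

end FreeScalar

/-! ### Degree-zero cohomology and the augmentation -/

namespace BVSym

variable {V W V' W' : Type} [AddCommGroup V] [Module ℂ V] [AddCommGroup W] [Module ℂ W]
  [AddCommGroup V'] [Module ℂ V'] [AddCommGroup W'] [Module ℂ W']

/-! Both states are the augmentation of `H⁰ Obs^cl(U)`. The augmentation kills exact elements, since
`d (P * v) = P * δ v` has no constant term; it is natural for maps of two-term complexes
(`augH0_comp_mapH0`) and it is a left inverse of `c ↦ [c]` (`augH0_unitH0`). Naturality along
extension by zero to `ℝ^d` handles the augmentation state. On the torus, once `c ↦ [c]` is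
bijective, its inverse has to be the augmentation, and naturality along `i` handles the
compactification state.

What remains is that bijectivity. If `δ` is surjective, every product with a factor from `W` is
exact, so only constants survive in `H⁰` (`unitH0_bijective`). Surjectivity of the massive operator
on smooth functions on the torus (`bvTorus_surjective`) is the analytic content. On the torus of
circumference one the operator multiplies the `n`-th Fourier coefficient by `-(m² + ∑ (2π nᵢ)²)`, of
absolute value at least `m² > 0`. Dividing by this factor preserves rapid decay of coefficients, and
a Fourier series with rapidly decaying coefficients is smooth and can be differentiated termwise.
Rescaling carries circumference `L` and mass `m` to circumference one and mass `m * L`. -/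

theorem augH0_unitH0 (δ : V →ₗ[ℂ] W) (c : ℂ) : augH0 δ (unitH0 δ c) = c := by
  simp [augH0, unitH0, aug_const]

theorem zeroEquiv_symm_one_eq_ιMulti (v : Fin 0 → V) :
    (exteriorPower.zeroEquiv ℂ V).symm 1 = exteriorPower.ιMulti ℂ 0 v := by
  rw [LinearEquiv.symm_apply_eq]
  simp

/-- A generator of `Sym W` has the form `δ y`, and `b * δ y` is the differential of `b ⊗ y`; hence
in `H⁰` a factor acts only through its constant term. The second factor `b` is arbitrary so that the
induction passes through products. -/
theorem mk_mul_of_surjective {δ : V →ₗ[ℂ] W} (hδ : Function.Surjective δ) (v : Fin 0 → V)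
    (a b : SymmetricAlgebra ℂ W) :
    (LinearMap.range (diff δ 0)).mkQ ((b * a) ⊗ₜ[ℂ] exteriorPower.ιMulti ℂ 0 v) =
      SymmetricAlgebra.algebraMapInv a •
        (LinearMap.range (diff δ 0)).mkQ (b ⊗ₜ[ℂ] exteriorPower.ιMulti ℂ 0 v) := by
  induction a using SymmetricAlgebra.induction generalizing b with
  | algebraMap r =>
    rw [SymmetricAlgebra.algebraMap_leftInverse (R := ℂ) W r, mul_comm, ← Algebra.smul_def,
      ← TensorProduct.smul_tmul', map_smul]
  | ι x =>
    obtain ⟨y, rfl⟩ := hδ x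
    rw [SymmetricAlgebra.algebraMapInv_ι, zero_smul, Submodule.mkQ_apply,
      Submodule.Quotient.mk_eq_zero]
    refine ⟨b ⊗ₜ[ℂ] exteriorPower.ιMulti ℂ 1 (fun _ => y), ?_⟩
    rw [diff_tmul]
    simp only [Nat.reduceAdd, Fin.sum_univ_one, Fin.val_zero, pow_zero, one_smul]
    congr 2
    exact Subsingleton.elim _ _
  | mul a a' ha ha' => rw [← mul_assoc, ha', ha, map_mul, mul_comm, mul_smul]
  | add a a' ha ha' => rw [mul_add, TensorProduct.add_tmul, map_add, ha, ha', map_add, add_smul]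

/-- If `δ` is surjective then `H⁰ (Sym (V → W)) = ℂ`. -/
theorem unitH0_bijective {δ : V →ₗ[ℂ] W} (hδ : Function.Surjective δ) :
    Function.Bijective (unitH0 δ) := by
  refine ⟨Function.LeftInverse.injective (augH0_unitH0 δ), LinearMap.range_eq_top.mp ?_⟩
  -- Surjectivity is stated as vanishing of the projection to the cokernel, an equality of linear
  -- maps that `hom_ext` reduces to pure tensors. There the class of `P` is its constant term times
  -- `[1]`.
  have h : (LinearMap.range (unitH0 δ)).mkQ ∘ₗ (LinearMap.range (diff δ 0)).mkQ = 0 := by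
    apply hom_ext
    intro v P
    have := mk_mul_of_surjective hδ v P 1
    rw [one_mul] at this
    rw [LinearMap.comp_apply, this, map_smul, LinearMap.zero_apply]
    have h1 : (LinearMap.range (unitH0 δ)).mkQ ((LinearMap.range (diff δ 0)).mkQ
        ((1 : SymmetricAlgebra ℂ W) ⊗ₜ[ℂ] exteriorPower.ιMulti ℂ 0 v)) = 0 := by
      rw [Submodule.mkQ_apply, Submodule.Quotient.mk_eq_zero]
      refine ⟨1, ?_⟩
      simp [unitH0, const, zeroEquiv_symm_one_eq_ιMulti v]
    rw [h1, smul_zero]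
  rw [eq_top_iff]
  rintro x -
  obtain ⟨y, rfl⟩ := Submodule.mkQ_surjective _ x
  have := LinearMap.congr_fun h y
  rwa [LinearMap.comp_apply, LinearMap.zero_apply, Submodule.mkQ_apply,
    Submodule.Quotient.mk_eq_zero] at this

/-- On `Sym` both sides are algebra maps that vanish on generators. -/
theorem aug_comp_map (f : V →ₗ[ℂ] V') (g : W →ₗ[ℂ] W') :
    aug V' W' ∘ₗ map f g 0 = aug V W := by
  have h : SymmetricAlgebra.algebraMapInv.comp (symMap g) =
      SymmetricAlgebra.algebraMapInv (R := ℂ) (M := W) := by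
    apply SymmetricAlgebra.algHom_ext
    ext x
    simp [symMap, SymmetricAlgebra.algebraMapInv_ι]
  apply hom_ext
  intro v P
  have hP := DFunLike.congr_fun h P
  rw [AlgHom.comp_apply] at hP
  simp [aug, map, hP]

/-- The augmentation on `H⁰` is natural. -/
theorem augH0_comp_mapH0 {δ : V →ₗ[ℂ] W} {δ' : V' →ₗ[ℂ] W'} (f : V →ₗ[ℂ] V') (g : W →ₗ[ℂ] W')
    (h : δ' ∘ₗ f = g ∘ₗ δ) : augH0 δ' ∘ₗ mapH0 f g h = augH0 δ := by
  apply Submodule.linearMap_qext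
  exact aug_comp_map f g

end BVSym

/-! ### Comparison of the states, embeddings into tori, and rescaling -/

namespace FreeScalar

variable {d : ℕ}

/-- By naturality both sides factor through the torus augmentation composed with `i`; the inverse of
`c ↦ [c]` equals that augmentation because the latter is a left inverse of a bijection. -/
theorem augState_comp_extendH0_eq_cptfState (m : ℝ) {L : ℝ} {U : Opens (E d)}
    (hU : Set.InjOn (proj d L) U) (hT : Function.Bijective (BVSym.unitH0 (bvTorus m d L))) :
    augState m d ∘ₗ extendH0 m U = cptfState m hU hT := by
  rw [augState, extendH0, BVSym.augH0_comp_mapH0,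
    ← BVSym.augH0_comp_mapH0 (toTorus hU) (toTorus hU) (bvTorus_toTorus m hU), cptfState, toTorusH0]
  congr 1
  refine LinearMap.ext fun x => ?_
  obtain ⟨c, rfl⟩ := hT.2 x
  rw [BVSym.augH0_unitH0]
  exact ((LinearEquiv.ofBijective _ hT).symm_apply_apply c).symm

/-- Points with the same image differ in each coordinate by a multiple of `L`, but coordinates in a
ball of radius `R` differ by at most `2R < L`. -/
theorem exists_injOn_proj {U : Set (E d)} (hU : Bornology.IsBounded U) :
    ∃ L₀ : ℝ, 0 < L₀ ∧ ∀ L : ℝ, L₀ ≤ L → Set.InjOn (proj d L) U := by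
  obtain ⟨R, hR⟩ := hU.subset_closedBall 0
  -- The maximum with `0` is needed because `R` may be negative when `U` is empty.
  refine ⟨max (2 * R) 0 + 1, by positivity, fun L hL x hx y hy hxy => ?_⟩
  have hL0 : 0 < L := lt_of_lt_of_le (by positivity) hL
  have hLR : 2 * R < L := by linarith [le_max_left (2 * R) 0]
  have hxR := hR hx
  have hyR := hR hy
  rw [mem_closedBall_zero_iff] at hxR hyR
  ext i
  have hi := congrFun hxy i
  simp only [proj] at hi
  rw [QuotientAddGroup.eq, AddSubgroup.mem_zmultiples_iff] at hi
  obtain ⟨k, hk⟩ := hi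
  have hxi : ‖x i‖ ≤ R := (PiLp.norm_apply_le x i).trans hxR
  have hyi : ‖y i‖ ≤ R := (PiLp.norm_apply_le y i).trans hyR
  rw [Real.norm_eq_abs, abs_le] at hxi hyi
  rw [zsmul_eq_mul] at hk
  have hk1 : (k : ℝ) < 1 := by
    by_contra! h
    nlinarith
  have hk2 : (-1 : ℝ) < k := by
    by_contra! h
    nlinarith
  have hk0 : k = 0 := by
    have h1 : k < 1 := by exact_mod_cast hk1
    have h2 : -1 < k := by exact_mod_cast hk2
    omega
  rw [hk0] at hk
  simp at hk
  linarith

/-- Rescaling of tori. -/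
noncomputable def torusScale (d : ℕ) {p q : ℝ} (hp : p ≠ 0) (hq : q ≠ 0) : Torus d p → Torus d q :=
  fun y i => AddCircle.equivAddCircle p q hp hq (y i)

theorem torusScale_proj {p q : ℝ} (hp : p ≠ 0) (hq : q ≠ 0) (x : E d) :
    torusScale d hp hq (proj d p x) = proj d q ((p⁻¹ * q) • x) := by
  funext i
  simp [torusScale, proj, mul_comm]

open Laplacian InnerProductSpace in
theorem laplacian_comp_const_smul {f : E d → ℂ} (hf : ContDiff ℝ 2 f) (a : ℝ) (x : E d) :
    Δ (fun v => f (a • v)) x = a ^ 2 • Δ f (a • x) := by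
  simp only [laplacian_eq_iteratedFDeriv_stdOrthonormalBasis]
  rw [iteratedFDeriv_comp_const_smul a hf]
  simp [Finset.mul_sum]

/-- It suffices to solve the equation of motion on the torus of circumference one. -/
theorem bvTorus_surjective_of_one
    (h1 : ∀ m : ℝ, 0 < m → Function.Surjective (bvTorus m d 1)) {m : ℝ} (hm : 0 < m) {L : ℝ}
    (hL : 0 < L) : Function.Surjective (bvTorus m d L) := by
  intro g
  have hg1 : (fun y => g.1 (torusScale d one_ne_zero hL.ne' y)) ∘ proj d 1 =
      fun x => (g.1 ∘ proj d L) (L • x) := by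
    funext x
    simp [torusScale_proj]
  have hs : ContDiff ℝ ∞ (fun x => (g.1 ∘ proj d L) (L • x)) :=
    ContDiff.comp (g := g.1 ∘ proj d L) g.2 (contDiff_const_smul L)
  -- If `v x = u (x / L)`, then `Δ v` is `L⁻²` times the rescaled `Δ u`. So mass `m` for `v` means
  -- mass `m * L` for `u`, with right-hand side `L² g (L x)`.
  obtain ⟨u, hu⟩ := h1 (m * L) (by positivity)
    (((L : ℂ) ^ 2) • ⟨fun y => g.1 (torusScale d one_ne_zero hL.ne' y), by
      change ContDiff ℝ ∞ _
      rw [hg1]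
      exact hs⟩)
  have hu1 : ContDiff ℝ ∞ (u.1 ∘ proj d 1) := u.2
  have hv : (fun y => u.1 (torusScale d hL.ne' one_ne_zero y)) ∘ proj d L =
      fun x => (u.1 ∘ proj d 1) (L⁻¹ • x) := by
    funext x
    simp [torusScale_proj]
  refine ⟨⟨fun y => u.1 (torusScale d hL.ne' one_ne_zero y), ?_⟩, ?_⟩
  · change ContDiff ℝ ∞ _
    rw [hv]
    exact hu1.comp (contDiff_const_smul L⁻¹)
  · apply Subtype.ext
    funext y
    obtain ⟨x, rfl⟩ := proj_surjective L y
    change eomTorus m _ (proj d L x) = _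
    rw [eomTorus_proj, hv]
    have h2 := congrFun (congrArg Subtype.val hu) (proj d 1 (L⁻¹ • x))
    change eomTorus (m * L) u.1 (proj d 1 (L⁻¹ • x)) =
      (L : ℂ) ^ 2 * g.1 (torusScale d one_ne_zero hL.ne' (proj d 1 (L⁻¹ • x))) at h2
    rw [eomTorus_proj, torusScale_proj, inv_one, one_mul, smul_inv_smul₀ hL.ne'] at h2
    have hLC : (L : ℂ) ≠ 0 := by exact_mod_cast hL.ne'
    have h3 : g.1 (proj d L x) = ((L : ℂ) ^ 2)⁻¹ * eom (m * L) (u.1 ∘ proj d 1) (L⁻¹ • x) := by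
      rw [h2]; field_simp
    rw [h3]
    simp only [eom]
    rw [laplacian_comp_const_smul (contDiff_infty.1 hu1 2)]
    simp only [Complex.real_smul]
    push_cast
    field_simp

end FreeScalar

/-! ### Smooth functions and directional derivatives on the torus -/

namespace FreeScalar

variable {d : ℕ}

/-- Transfers continuity from `ℝ^d`, where smoothness is tested, down to the torus. -/
theorem isOpenQuotientMap_proj (L : ℝ) : IsOpenQuotientMap (proj d L) := by
  have h : IsOpenQuotientMap (Pi.map fun (_ : Fin d) (x : ℝ) => (x : AddCircle L)) :=
    IsOpenQuotientMap.piMap fun _ => QuotientAddGroup.isOpenQuotientMap_mk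
  exact h.comp (PiLp.homeomorph 2 fun _ : Fin d => ℝ).isOpenQuotientMap

theorem continuous_of_mem_smoothTorus {L : ℝ} {g : Torus d L → ℂ} (hg : g ∈ SmoothTorus d L) :
    Continuous g :=
  (isOpenQuotientMap_proj L).continuous_comp_iff.1 (ContDiff.continuous (𝕜 := ℝ) (n := ∞) hg)

/-- The derivative of a function on the torus in the direction `v`. -/
noncomputable def torusDeriv {L : ℝ} (v : E d) (g : Torus d L → ℂ) : Torus d L → ℂ :=
  fun y => fderiv ℝ (fun w : E d => g (y + proj d L w)) 0 v

theorem torusDeriv_proj {L : ℝ} (v : E d) (g : Torus d L → ℂ) (x : E d) :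
    torusDeriv v g (proj d L x) = fderiv ℝ (g ∘ proj d L) x v := by
  have h := fderiv_comp_add_left (𝕜 := ℝ) (f := g ∘ proj d L) (x := 0) x
  rw [add_zero] at h
  rw [← h]
  simp only [torusDeriv, Function.comp_apply, proj_add]

theorem torusDeriv_mem {L : ℝ} (v : E d) {g : Torus d L → ℂ} (hg : g ∈ SmoothTorus d L) :
    torusDeriv v g ∈ SmoothTorus d L := by
  change ContDiff ℝ ∞ (g ∘ proj d L) at hg
  change ContDiff ℝ ∞ (torusDeriv v g ∘ proj d L)
  have h : torusDeriv v g ∘ proj d L = fun x => fderiv ℝ (g ∘ proj d L) x v :=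
    funext fun x => torusDeriv_proj v g x
  rw [h]
  exact (hg.fderiv_right (m := ∞) le_rfl).clm_apply contDiff_const

theorem torusDeriv_mul {L : ℝ} (v : E d) {f g : Torus d L → ℂ} (hf : f ∈ SmoothTorus d L)
    (hg : g ∈ SmoothTorus d L) :
    torusDeriv v (f * g) = f * torusDeriv v g + torusDeriv v f * g := by
  funext y
  obtain ⟨x, rfl⟩ := proj_surjective L y
  simp only [Pi.add_apply, Pi.mul_apply, torusDeriv_proj]
  have hf' : DifferentiableAt ℝ (f ∘ proj d L) x :=
    (ContDiff.differentiable (n := ∞) hf (by simp)) x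
  have hg' : DifferentiableAt ℝ (g ∘ proj d L) x :=
    (ContDiff.differentiable (n := ∞) hg (by simp)) x
  have h : (f * g) ∘ proj d L = (f ∘ proj d L) * (g ∘ proj d L) := rfl
  rw [h, fderiv_mul hf' hg']
  simp [mul_comm]

theorem mul_mem_smoothTorus {L : ℝ} {f g : Torus d L → ℂ} (hf : f ∈ SmoothTorus d L)
    (hg : g ∈ SmoothTorus d L) : f * g ∈ SmoothTorus d L :=
  ContDiff.mul (𝕜 := ℝ) (n := ∞) (f := f ∘ proj d L) (g := g ∘ proj d L) hf hg

theorem hasDerivAt_torusDeriv {L : ℝ} (v : E d) {g : Torus d L → ℂ} (hg : g ∈ SmoothTorus d L)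
    (y : Torus d L) (s : ℝ) :
    HasDerivAt (fun s : ℝ => g (y + proj d L (s • v))) (torusDeriv v g (y + proj d L (s • v))) s := by
  obtain ⟨x, rfl⟩ := proj_surjective L y
  simp only [← proj_add, torusDeriv_proj]
  have hg' : HasFDerivAt (g ∘ proj d L) (fderiv ℝ (g ∘ proj d L) (x + s • v)) (x + s • v) :=
    ((ContDiff.differentiable (n := ∞) hg (by simp)) _).hasFDerivAt
  have h1 : HasDerivAt (fun s : ℝ => x + s • v) v s := by
    simpa using ((hasDerivAt_id s).smul_const v).const_add x
  exact hg'.comp_hasDerivAt s h1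

/-- The equation of motion operator in terms of iterated torus derivatives. -/
theorem eomTorus_eq_sum {L : ℝ} (m : ℝ) {g : Torus d L → ℂ} (hg : g ∈ SmoothTorus d L) :
    eomTorus m g = ∑ i : Fin d, torusDeriv (EuclideanSpace.single i 1)
      (torusDeriv (EuclideanSpace.single i 1) g) - (m : ℂ) ^ 2 • g := by
  funext y
  obtain ⟨x, rfl⟩ := proj_surjective L y
  rw [eomTorus_proj, eom, InnerProductSpace.laplacian_eq_iteratedFDeriv_orthonormalBasis _
    (EuclideanSpace.basisFun (Fin d) ℝ)]
  simp only [Pi.sub_apply, Finset.sum_apply, Pi.smul_apply, smul_eq_mul, neg_add_rev, neg_neg,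
    Function.comp_apply, EuclideanSpace.basisFun_apply]
  rw [sub_eq_neg_add]
  congr 1
  refine Finset.sum_congr rfl fun i _ => ?_
  rw [torusDeriv_proj, iteratedFDeriv_two_apply]
  have h : torusDeriv (EuclideanSpace.single i 1) g ∘ proj d L =
      fun x => fderiv ℝ (g ∘ proj d L) x (EuclideanSpace.single i 1) :=
    funext fun x => torusDeriv_proj _ g x
  have hd : DifferentiableAt ℝ (fderiv ℝ (g ∘ proj d L)) x :=
    (ContDiff.differentiable (n := ∞)
      (ContDiff.fderiv_right (n := ∞) (m := ∞) hg le_rfl) (by simp)) x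
  rw [h, fderiv_clm_apply hd (differentiableAt_const _)]
  simp

/-! ### Fourier coefficients on the torus of circumference one -/

open MeasureTheory UnitAddTorus

/-- The normalised Haar measure on `(ℝ / ℤ)^d`. -/
noncomputable abbrev torusHaar (d : ℕ) : Measure (Torus d 1) :=
  Measure.pi fun _ => AddCircle.haarAddCircle

theorem integrable_of_mem_smoothTorus {g : Torus d 1 → ℂ} (hg : g ∈ SmoothTorus d 1) :
    Integrable g (torusHaar d) :=
  (continuous_of_mem_smoothTorus hg).integrable_of_hasCompactSupport
    (HasCompactSupport.of_compactSpace g)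

theorem exists_norm_le_of_mem_smoothTorus {g : Torus d 1 → ℂ} (hg : g ∈ SmoothTorus d 1) :
    ∃ C, ∀ y, ‖g y‖ ≤ C := by
  obtain ⟨C, hC⟩ := isCompact_univ.exists_bound_of_continuousOn
    (continuous_of_mem_smoothTorus hg).continuousOn
  exact ⟨C, fun y => hC y trivial⟩

/-- By translation invariance `∫ g (y + s v) dy` does not depend on `s`; differentiate under the
integral at `s = 0`, dominated by the maximum of the derivative on the compact torus. -/
theorem integral_torusDeriv (v : E d) {g : Torus d 1 → ℂ} (hg : g ∈ SmoothTorus d 1) :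
    ∫ y, torusDeriv v g y ∂torusHaar d = 0 := by
  have hg' := torusDeriv_mem v hg
  obtain ⟨C, hC⟩ := exists_norm_le_of_mem_smoothTorus hg'
  have hc := continuous_of_mem_smoothTorus hg
  have h := (hasDerivAt_integral_of_dominated_loc_of_deriv_le (μ := torusHaar d) (x₀ := (0 : ℝ))
    (s := Set.univ) (F := fun s y => g (y + proj d 1 (s • v)))
    (F' := fun s y => torusDeriv v g (y + proj d 1 (s • v))) (bound := fun _ => C)
    Filter.univ_mem
    (Filter.Eventually.of_forall fun s =>
      (hc.comp (continuous_add_const _)).aestronglyMeasurable)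
    ((integrable_of_mem_smoothTorus hg).comp_add_right _)
    ((continuous_of_mem_smoothTorus hg').comp (continuous_add_const _)).aestronglyMeasurable
    (Filter.Eventually.of_forall fun y s _ => hC _) (integrable_const C)
    (Filter.Eventually.of_forall fun y s _ => hasDerivAt_torusDeriv v hg y s)).2
  simp only [integral_add_right_eq_self g] at h
  rw [integral_add_right_eq_self (torusDeriv v g)] at h
  exact h.unique (hasDerivAt_const _ _)

/-- The linear form `x ↦ 2π ⟨n, x⟩`. -/
noncomputable def freq (n : Fin d → ℤ) : E d →L[ℝ] ℝ :=
  (2 * Real.pi) • ∑ i, (n i : ℝ) • EuclideanSpace.proj i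

theorem mFourier_proj (n : Fin d → ℤ) (x : E d) :
    mFourier n (proj d 1 x) = Complex.exp (freq n x * Complex.I) := by
  simp only [mFourier, ContinuousMap.coe_mk, proj, fourier_coe_apply, ← Complex.exp_sum]
  congr 1
  simp [freq, Finset.mul_sum, Finset.sum_mul]
  refine Finset.sum_congr rfl fun i _ => ?_
  ring

theorem mFourier_comp_proj (n : Fin d → ℤ) :
    mFourier n ∘ proj d 1 = (fun t : ℝ => Complex.exp (t * Complex.I)) ∘ freq n :=
  funext fun x => mFourier_proj n x

theorem contDiff_exp_ofReal_mul_I : ContDiff ℝ ∞ fun t : ℝ => Complex.exp (t * Complex.I) :=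
  (Complex.ofRealCLM.contDiff.mul contDiff_const).cexp

theorem mFourier_mem (n : Fin d → ℤ) : (mFourier n : Torus d 1 → ℂ) ∈ SmoothTorus d 1 := by
  change ContDiff ℝ ∞ (mFourier n ∘ proj d 1)
  rw [mFourier_comp_proj]
  exact contDiff_exp_ofReal_mul_I.comp (freq n).contDiff

theorem torusDeriv_mFourier (v : E d) (n : Fin d → ℤ) :
    torusDeriv v (mFourier n : Torus d 1 → ℂ) = (freq n v * Complex.I) • ⇑(mFourier n) := by
  funext y
  obtain ⟨x, rfl⟩ := proj_surjective 1 y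
  rw [torusDeriv_proj, mFourier_comp_proj, Pi.smul_apply, mFourier_proj]
  have h1 : HasDerivAt (fun t : ℝ => Complex.exp (t * Complex.I))
      (Complex.exp (freq n x * Complex.I) * (1 * Complex.I)) (freq n x) :=
    ((hasDerivAt_id (freq n x)).ofReal_comp.mul_const Complex.I).cexp
  have h2 : HasFDerivAt ((fun t : ℝ => Complex.exp (t * Complex.I)) ∘ freq n)
      ((Complex.exp (freq n x * Complex.I) * (1 * Complex.I)) • (freq n).smulRight (1 : ℂ)) x := by
    refine (h1.hasFDerivAt.comp x (freq n).hasFDerivAt).congr_fderiv ?_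
    ext w
    simp [mul_comm]
  rw [h2.fderiv]
  simp
  ring

theorem freq_single (n : Fin d → ℤ) (i : Fin d) :
    freq n (EuclideanSpace.single i 1) = 2 * Real.pi * n i := by
  simp [freq, PiLp.single_apply]

theorem mFourierCoeff_eq (g : Torus d 1 → ℂ) (n : Fin d → ℤ) :
    mFourierCoeff g n = ∫ y, mFourier (-n) y * g y ∂torusHaar d := rfl

theorem freq_neg (n : Fin d → ℤ) (v : E d) : freq (-n) v = -freq n v := by
  simp [freq]

/-- Integration by parts: the derivative of `mFourier (-n) * g` has integral zero, and the Leibniz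
rule splits it. -/
theorem mFourierCoeff_torusDeriv (v : E d) {g : Torus d 1 → ℂ} (hg : g ∈ SmoothTorus d 1)
    (n : Fin d → ℤ) :
    mFourierCoeff (torusDeriv v g) n = freq n v * Complex.I * mFourierCoeff g n := by
  have h := integral_torusDeriv v (mul_mem_smoothTorus (mFourier_mem (-n)) hg)
  rw [torusDeriv_mul v (mFourier_mem (-n)) hg, torusDeriv_mFourier] at h
  have h1 := integrable_of_mem_smoothTorus
    (mul_mem_smoothTorus (mFourier_mem (-n)) (torusDeriv_mem v hg))
  have h2 := integrable_of_mem_smoothTorus (mul_mem_smoothTorus (mFourier_mem (-n)) hg)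
  rw [smul_mul_assoc, integral_add' h1 (h2.smul _)] at h
  simp only [Pi.smul_apply, integral_smul] at h
  rw [mFourierCoeff_eq, mFourierCoeff_eq]
  simp only [Pi.mul_apply, smul_eq_mul, freq_neg, Complex.ofReal_neg] at h
  linear_combination h

/-- The symbol of the operator `-Δ + m²`. -/
noncomputable def symbol (m : ℝ) (n : Fin d → ℤ) : ℝ := m ^ 2 + ∑ i, (2 * Real.pi * n i) ^ 2

theorem mFourierCoeff_eomTorus (m : ℝ) {g : Torus d 1 → ℂ} (hg : g ∈ SmoothTorus d 1)
    (n : Fin d → ℤ) : mFourierCoeff (eomTorus m g) n = -symbol m n * mFourierCoeff g n := by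
  have hi : ∀ i : Fin d, torusDeriv (EuclideanSpace.single i 1)
      (torusDeriv (EuclideanSpace.single i 1) g) ∈ SmoothTorus d 1 :=
    fun i => torusDeriv_mem _ (torusDeriv_mem _ hg)
  have hadd : mFourierCoeff (eomTorus m g) n = ∑ i : Fin d, mFourierCoeff
      (torusDeriv (EuclideanSpace.single i 1) (torusDeriv (EuclideanSpace.single i 1) g)) n -
      (m : ℂ) ^ 2 * mFourierCoeff g n := by
    simp only [mFourierCoeff_eq, eomTorus_eq_sum m hg, Pi.sub_apply, Finset.sum_apply,
      Pi.smul_apply, smul_eq_mul, mul_sub, Finset.mul_sum]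
    have hint : ∀ {f : Torus d 1 → ℂ}, f ∈ SmoothTorus d 1 →
        Integrable (fun y => mFourier (-n) y * f y) (torusHaar d) := fun hf =>
      integrable_of_mem_smoothTorus (mul_mem_smoothTorus (mFourier_mem (-n)) hf)
    rw [integral_sub (integrable_finsetSum _ fun i _ => hint (hi i)),
      integral_finsetSum _ fun i _ => hint (hi i)]
    · simp only [mul_left_comm _ ((m : ℂ) ^ 2), integral_const_mul]
    · simpa only [mul_left_comm _ ((m : ℂ) ^ 2)] using (hint hg).const_mul ((m : ℂ) ^ 2)
  rw [hadd]
  simp only [mFourierCoeff_torusDeriv _ (torusDeriv_mem _ hg), mFourierCoeff_torusDeriv _ hg,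
    freq_single, symbol]
  push_cast
  have hI : ∀ a b : ℂ, a * Complex.I * (a * Complex.I * b) = -(a ^ 2 * b) := fun a b => by
    linear_combination a ^ 2 * b * Complex.I_sq
  simp only [hI, Finset.sum_neg_distrib, ← Finset.sum_mul]
  ring

theorem norm_mFourierCoeff_le {g : Torus d 1 → ℂ} {C : ℝ} (hC : ∀ y, ‖g y‖ ≤ C)
    (n : Fin d → ℤ) : ‖mFourierCoeff g n‖ ≤ C := by
  rw [mFourierCoeff_eq]
  have h : ∀ y, ‖mFourier (-n) y * g y‖ ≤ C := fun y => by
    rw [norm_mul]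
    refine (mul_le_of_le_one_left (norm_nonneg _) ?_).trans (hC y)
    exact ((mFourier (-n)).norm_coe_le_norm y).trans_eq mFourier_norm
  simpa using norm_integral_le_of_norm_le_const (μ := torusHaar d)
    (Filter.Eventually.of_forall h)

/-- The mass-one symbol is the weight in all decay estimates, whatever the mass in the equation. -/
theorem one_le_symbol (n : Fin d → ℤ) : 1 ≤ symbol 1 n := by
  rw [symbol, one_pow, le_add_iff_nonneg_right]
  positivity

/-- Rapid decay of Fourier coefficients. -/
theorem exists_symbol_pow_mul_norm_mFourierCoeff_le (k : ℕ) {g : Torus d 1 → ℂ}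
    (hg : g ∈ SmoothTorus d 1) :
    ∃ C, ∀ n : Fin d → ℤ, symbol 1 n ^ k * ‖mFourierCoeff g n‖ ≤ C := by
  induction k generalizing g with
  | zero =>
    obtain ⟨C, hC⟩ := exists_norm_le_of_mem_smoothTorus hg
    exact ⟨C, fun n => by simpa using norm_mFourierCoeff_le hC n⟩
  | succ k ih =>
    -- Applying the operator of mass one multiplies the coefficients by `-symbol 1 n`, which gains
    -- one power of the weight.
    obtain ⟨C, hC⟩ := ih (eomTorus_mem 1 hg)
    refine ⟨C, fun n => (le_of_eq ?_).trans (hC n)⟩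
    rw [mFourierCoeff_eomTorus 1 hg, norm_mul, norm_neg, Complex.norm_real, Real.norm_eq_abs,
      abs_of_nonneg (zero_le_one.trans (one_le_symbol n)), pow_succ, mul_assoc]

/-- A finite set of multi-indices lies in a box, and over a box the sum of products is the product
of one-variable sums. -/
theorem summable_pi_prod {ι α : Type*} [Fintype ι] [DecidableEq ι] {f : α → ℝ} (hf : Summable f)
    (h0 : ∀ a, 0 ≤ f a) : Summable fun n : ι → α => ∏ i, f (n i) := by
  classical
  refine summable_of_sum_le (c := ∏ _i : ι, ∑' a, f a)
    (fun n => Finset.prod_nonneg fun i _ => h0 _) fun s => ?_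
  calc ∑ n ∈ s, ∏ i, f (n i)
      ≤ ∑ n ∈ Fintype.piFinset fun i => s.image fun n => n i, ∏ i, f (n i) := by
        refine Finset.sum_le_sum_of_subset_of_nonneg (fun n hn => ?_)
          fun n _ _ => Finset.prod_nonneg fun i _ => h0 _
        rw [Fintype.mem_piFinset]
        exact fun i => Finset.mem_image_of_mem _ hn
    _ = ∏ i, ∑ a ∈ s.image fun n => n i, f a := (Finset.prod_univ_sum _ _).symm
    _ ≤ ∏ _i : ι, ∑' a, f a :=
        Finset.prod_le_prod (fun i _ => Finset.sum_nonneg fun a _ => h0 a)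
          fun i _ => hf.sum_le_tsum _ fun a _ => h0 a

theorem one_add_sq_le_symbol (n : Fin d → ℤ) (i : Fin d) : 1 + (n i : ℝ) ^ 2 ≤ symbol 1 n := by
  rw [symbol, one_pow]
  have h1 : (2 * Real.pi * n i) ^ 2 ≤ ∑ i, (2 * Real.pi * n i) ^ 2 :=
    Finset.single_le_sum (f := fun i => (2 * Real.pi * n i) ^ 2) (fun i _ => by positivity)
      (Finset.mem_univ i)
  have h2 : 1 ≤ (2 * Real.pi) ^ 2 := by nlinarith [Real.pi_gt_three]
  rw [mul_pow] at h1
  nlinarith [sq_nonneg (n i : ℝ)]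

/-- Spending one factor of the symbol on each coordinate gives `symbol 1 n ^ d ≥ ∏ (1 + nᵢ²)`,
reducing to a convergent series in one variable. -/
theorem summable_inv_symbol_pow (d : ℕ) :
    Summable fun n : Fin d → ℤ => (symbol 1 n ^ d)⁻¹ := by
  have h1 : Summable fun a : ℤ => (1 + (a : ℝ) ^ 2)⁻¹ := by
    have h2 : Summable fun a : ℤ => 1 / (a : ℝ) ^ 2 :=
      Real.summable_one_div_int_pow.2 one_lt_two
    -- The comparison fails at `a = 0`, where `1 / a ^ 2` is `0` by convention, so it is made off a
    -- finite set.
    refine Summable.of_norm_bounded_eventually h2 ?_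
    have h3 : ∀ᶠ a : ℤ in Filter.cofinite, a ≠ 0 :=
      (Set.finite_singleton 0).eventually_cofinite_notMem
    filter_upwards [h3] with a ha
    have : 0 < (a : ℝ) ^ 2 := by positivity
    rw [Real.norm_of_nonneg (by positivity), one_div]
    exact inv_anti₀ this (by linarith)
  refine Summable.of_nonneg_of_le
    (fun n => inv_nonneg.2 (pow_nonneg (zero_le_one.trans (one_le_symbol n)) d)) (fun n => ?_)
    (summable_pi_prod (ι := Fin d) h1 fun a => by positivity)
  rw [Finset.prod_inv_distrib]
  refine inv_anti₀ (Finset.prod_pos fun i _ => by positivity) ?_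
  calc ∏ i, (1 + (n i : ℝ) ^ 2) ≤ ∏ _i : Fin d, symbol 1 n :=
        Finset.prod_le_prod (fun i _ => by positivity) fun i _ => one_add_sq_le_symbol n i
    _ = symbol 1 n ^ d := by simp

theorem summable_symbol_pow_mul_norm_mFourierCoeff (k : ℕ) {g : Torus d 1 → ℂ}
    (hg : g ∈ SmoothTorus d 1) :
    Summable fun n : Fin d → ℤ => symbol 1 n ^ k * ‖mFourierCoeff g n‖ := by
  -- The `d` extra powers pay for summability.
  obtain ⟨C, hC⟩ := exists_symbol_pow_mul_norm_mFourierCoeff_le (k + d) hg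
  have hpos : ∀ n : Fin d → ℤ, 0 < symbol 1 n := fun n => zero_lt_one.trans_le (one_le_symbol n)
  refine Summable.of_nonneg_of_le (fun n => by have := hpos n; positivity) (fun n => ?_)
    ((summable_inv_symbol_pow d).mul_left C)
  have := hpos n
  rw [← div_eq_mul_inv, le_div_iff₀ (by positivity)]
  refine (le_of_eq ?_).trans (hC n)
  ring

/-- By Cauchy–Schwarz the norm is at most `√S` with `S = ∑ (2π nᵢ)²`, and `√S ≤ 1 + S`. The bound is
crude, but it keeps a single weight for derivatives and coefficients. -/
theorem norm_freq_le (n : Fin d → ℤ) : ‖freq n‖ ≤ symbol 1 n := by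
  refine ContinuousLinearMap.opNorm_le_bound _ (zero_le_one.trans (one_le_symbol n)) fun x => ?_
  have h : freq n x = inner ℝ (WithLp.toLp 2 fun i => 2 * Real.pi * (n i : ℝ)) x := by
    simp [freq, PiLp.inner_apply, Finset.mul_sum]
    exact Finset.sum_congr rfl fun i _ => by ring
  rw [h]
  refine (norm_inner_le_norm _ _).trans ?_
  refine mul_le_mul_of_nonneg_right ?_ (norm_nonneg _)
  rw [EuclideanSpace.norm_eq]
  simp only [Real.norm_eq_abs, sq_abs, symbol, one_pow]
  set S := ∑ i, (2 * Real.pi * (n i : ℝ)) ^ 2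
  have hS : 0 ≤ S := by positivity
  rw [Real.sqrt_le_left (by positivity)]
  nlinarith

theorem iteratedDeriv_exp_ofReal_mul_I (k : ℕ) :
    iteratedDeriv k (fun t : ℝ => Complex.exp (t * Complex.I)) =
      fun t : ℝ => Complex.I ^ k * Complex.exp (t * Complex.I) := by
  induction k with
  | zero => simp
  | succ k ih =>
    rw [iteratedDeriv_succ, ih]
    funext t
    have h : HasDerivAt (fun t : ℝ => Complex.I ^ k * Complex.exp (t * Complex.I))
        (Complex.I ^ k * (Complex.exp (t * Complex.I) * (1 * Complex.I))) t :=
      ((hasDerivAt_id t).ofReal_comp.mul_const Complex.I).cexp.const_mul _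
    rw [h.deriv]
    ring

/-- The character is `t ↦ exp (i t)` after the linear form `freq n`: the outer derivatives have norm
one, and each of the `k` slots costs `‖freq n‖`. -/
theorem norm_iteratedFDeriv_mFourier_le (n : Fin d → ℤ) (k : ℕ) (x : E d) :
    ‖iteratedFDeriv ℝ k (mFourier n ∘ proj d 1) x‖ ≤ symbol 1 n ^ k := by
  rw [mFourier_comp_proj, ContinuousLinearMap.iteratedFDeriv_comp_right (freq n)
    contDiff_exp_ofReal_mul_I x (i := k) (by exact_mod_cast le_top)]
  refine (ContinuousMultilinearMap.norm_compContinuousLinearMap_le _ _).trans ?_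
  rw [norm_iteratedFDeriv_eq_norm_iteratedDeriv, iteratedDeriv_exp_ofReal_mul_I, norm_mul, norm_pow,
    Complex.norm_I, one_pow, Complex.norm_exp_ofReal_mul_I, one_mul, one_mul, Finset.prod_const,
    Finset.card_univ, Fintype.card_fin]
  exact pow_le_pow_left₀ (norm_nonneg _) (norm_freq_le n) k

/-! ### Fourier series with rapidly decaying coefficients -/

theorem eom_mFourier (m : ℝ) (n : Fin d → ℤ) (x : E d) :
    eom m (mFourier n ∘ proj d 1) x = -symbol m n * mFourier n (proj d 1 x) := by
  rw [← eomTorus_proj, eomTorus_eq_sum m (mFourier_mem n)]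
  have h : ∀ i : Fin d, torusDeriv (EuclideanSpace.single i 1) (torusDeriv
      (EuclideanSpace.single i 1) (mFourier n : Torus d 1 → ℂ)) (proj d 1 x) =
      -((2 * Real.pi * n i) ^ 2 * mFourier n (proj d 1 x)) := fun i => by
    have hs : torusDeriv (EuclideanSpace.single i 1) (mFourier n : Torus d 1 → ℂ) ∘ proj d 1 =
        fun x => (freq n (EuclideanSpace.single i 1) * Complex.I) *
          (mFourier n ∘ proj d 1) x := by
      rw [torusDeriv_mFourier]
      rfl
    rw [torusDeriv_proj, hs, fderiv_const_mul
      ((ContDiff.differentiable (n := ∞) (mFourier_mem n) (by simp)) x)]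
    rw [smul_apply, ← torusDeriv_proj, torusDeriv_mFourier, freq_single]
    simp only [Pi.smul_apply, smul_eq_mul]
    push_cast
    linear_combination (2 * Real.pi * n i : ℂ) ^ 2 * mFourier n (proj d 1 x) * Complex.I_sq
  simp only [Pi.sub_apply, Finset.sum_apply, h, Pi.smul_apply, smul_eq_mul, symbol,
    Finset.sum_neg_distrib, ← Finset.sum_mul]
  push_cast
  ring

end FreeScalar

namespace FreeScalar

variable {d : ℕ}

open UnitAddTorus

theorem norm_iteratedFDeriv_smul_mFourier_le (c : ℂ) (n : Fin d → ℤ) (k : ℕ) (x : E d) :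
    ‖iteratedFDeriv ℝ k (c • (mFourier n ∘ proj d 1)) x‖ ≤ symbol 1 n ^ k * ‖c‖ := by
  have hs : ContDiff ℝ ∞ (mFourier n ∘ proj d 1) := mFourier_mem n
  rw [iteratedFDeriv_const_smul_apply (contDiff_infty.1 hs k).contDiffAt, norm_smul, mul_comm]
  exact mul_le_mul_of_nonneg_right (norm_iteratedFDeriv_mFourier_le n k x) (norm_nonneg c)

/-- The function on the torus with Fourier coefficients `b`. -/
noncomputable def fourierSeries (b : (Fin d → ℤ) → ℂ) : Torus d 1 → ℂ :=
  fun y => ∑' n, b n * mFourier n y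

theorem fourierSeries_comp_proj (b : (Fin d → ℤ) → ℂ) :
    fourierSeries b ∘ proj d 1 = fun x => ∑' n, (b n • (mFourier n ∘ proj d 1)) x := rfl

theorem contDiff_smul_mFourier (c : ℂ) (n : Fin d → ℤ) :
    ContDiff ℝ ∞ (c • (mFourier n ∘ proj d 1)) :=
  ContDiff.const_smul (f := mFourier n ∘ proj d 1) c (mFourier_mem n)

theorem fourierSeries_mem {b : (Fin d → ℤ) → ℂ}
    (hb : ∀ k : ℕ, Summable fun n => symbol 1 n ^ k * ‖b n‖) :
    fourierSeries b ∈ SmoothTorus d 1 := by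
  change ContDiff ℝ ∞ (fourierSeries b ∘ proj d 1)
  rw [fourierSeries_comp_proj]
  exact contDiff_tsum (fun n => contDiff_smul_mFourier (b n) n) (fun k _ => hb k)
    fun k n x _ => norm_iteratedFDeriv_smul_mFourier_le (b n) n k x

/-- The weighted summability dominates the derivatives of the terms, so the second derivative is
taken termwise; each character is an eigenfunction. -/
theorem eom_fourierSeries (m : ℝ) {b : (Fin d → ℤ) → ℂ}
    (hb : ∀ k : ℕ, Summable fun n => symbol 1 n ^ k * ‖b n‖) (x : E d) :
    eom m (fourierSeries b ∘ proj d 1) x =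
      ∑' n, -symbol m n * b n * mFourier n (proj d 1 x) := by
  have hle := fun k n x => norm_iteratedFDeriv_smul_mFourier_le (d := d) (b n) n k x
  have hsum : ∀ k, Summable fun n => iteratedFDeriv ℝ k (b n • (mFourier n ∘ proj d 1)) x :=
    fun k => (hb k).of_norm_bounded fun n => hle k n x
  have h2 : HasSum (fun n => iteratedFDeriv ℝ 2 (b n • (mFourier n ∘ proj d 1)) x)
      (iteratedFDeriv ℝ 2 (fourierSeries b ∘ proj d 1) x) := by
    have h := iteratedFDeriv_tsum_apply (N := ⊤) (k := 2)
      (fun n => contDiff_smul_mFourier (b n) n) (fun k _ => hb k) (fun k n x _ => hle k n x)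
      (by exact_mod_cast le_top) x
    rw [fourierSeries_comp_proj, h]
    exact (hsum 2).hasSum
  have hΔ : ∀ v : E d, HasSum
      (fun n => iteratedFDeriv ℝ 2 (b n • (mFourier n ∘ proj d 1)) x ![v, v])
      (iteratedFDeriv ℝ 2 (fourierSeries b ∘ proj d 1) x ![v, v]) := fun v =>
    ContinuousMultilinearMap.hasSum_eval h2 ![v, v]
  have h0 : HasSum (fun n => (b n • (mFourier n ∘ proj d 1)) x)
      ((fourierSeries b ∘ proj d 1) x) := by
    refine Summable.hasSum ((hb 0).of_norm_bounded fun n => ?_)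
    have := hle 0 n x
    rwa [norm_iteratedFDeriv_zero] at this
  have h : HasSum (fun n => eom m (b n • (mFourier n ∘ proj d 1)) x)
      (eom m (fourierSeries b ∘ proj d 1) x) := by
    simp only [eom, InnerProductSpace.laplacian_eq_iteratedFDeriv_stdOrthonormalBasis]
    exact ((hasSum_sum fun i _ => hΔ _).neg.add (h0.mul_left _)).neg
  rw [← h.tsum_eq]
  refine tsum_congr fun n => ?_
  rw [eom_smul m (b n) (mFourier_mem n), Pi.smul_apply, eom_mFourier, smul_eq_mul]
  ring

theorem sq_le_symbol (m : ℝ) (n : Fin d → ℤ) : m ^ 2 ≤ symbol m n := by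
  rw [symbol, le_add_iff_nonneg_right]
  positivity

/-- Smooth functions on the torus are the sum of their Fourier series. -/
theorem fourierSeries_mFourierCoeff {g : Torus d 1 → ℂ} (hg : g ∈ SmoothTorus d 1)
    (y : Torus d 1) : ∑' n, mFourierCoeff g n * mFourier n y = g y := by
  have hs : Summable (mFourierCoeff g) := by
    refine Summable.of_norm ?_
    simpa using summable_symbol_pow_mul_norm_mFourierCoeff 0 hg
  exact (hasSum_mFourier_series_apply_of_summable
    (f := ⟨g, continuous_of_mem_smoothTorus hg⟩) hs y).tsum_eq

/-- The massive operator is surjective on smooth functions on the torus of circumference one. -/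
theorem bvTorus_one_surjective {m : ℝ} (hm : 0 < m) : Function.Surjective (bvTorus m d 1) := by
  rintro ⟨g, hg⟩
  have hpos : ∀ n : Fin d → ℤ, 0 < symbol m n := fun n =>
    (pow_pos hm 2).trans_le (sq_le_symbol m n)
  -- The Fourier coefficients that the solution must have. Since `symbol m n ≥ m²`, the division
  -- costs at most the factor `(m²)⁻¹` in every decay estimate.
  set b : (Fin d → ℤ) → ℂ := fun n => -(symbol m n : ℂ)⁻¹ * mFourierCoeff g n with hbdef
  have hb : ∀ k : ℕ, Summable fun n => symbol 1 n ^ k * ‖b n‖ := fun k => by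
    refine Summable.of_nonneg_of_le (fun n => mul_nonneg
      (pow_nonneg (zero_le_one.trans (one_le_symbol n)) k) (norm_nonneg _)) (fun n => ?_)
      ((summable_symbol_pow_mul_norm_mFourierCoeff k hg).mul_left (m ^ 2)⁻¹)
    rw [hbdef, norm_mul, norm_neg, norm_inv, Complex.norm_real, Real.norm_of_nonneg (hpos n).le,
      mul_left_comm]
    refine mul_le_mul_of_nonneg_right (inv_anti₀ (by positivity) (sq_le_symbol m n)) ?_
    exact mul_nonneg (pow_nonneg (zero_le_one.trans (one_le_symbol n)) k) (norm_nonneg _)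
  refine ⟨⟨fourierSeries b, fourierSeries_mem hb⟩, Subtype.ext (funext fun y => ?_)⟩
  obtain ⟨x, rfl⟩ := proj_surjective 1 y
  change eomTorus m (fourierSeries b) (proj d 1 x) = g (proj d 1 x)
  rw [eomTorus_proj, eom_fourierSeries m hb, ← fourierSeries_mFourierCoeff hg]
  refine tsum_congr fun n => ?_
  have : (symbol m n : ℂ) ≠ 0 := by exact_mod_cast (hpos n).ne'
  simp only [hbdef]
  field_simp

/-- The massive operator is surjective on smooth functions on every torus. -/
theorem bvTorus_surjective {m : ℝ} (hm : 0 < m) {L : ℝ} (hL : 0 < L) :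
    Function.Surjective (bvTorus m d L) :=
  bvTorus_surjective_of_one (fun _ => bvTorus_one_surjective) hm hL

end FreeScalar

theorem mainTheorem7 (d : ℕ) (m : ℝ) (hm : 0 < m)
    (U : TopologicalSpace.Opens (FreeScalar.E d))
    (hU : Bornology.IsBounded (U : Set (FreeScalar.E d))) :
    (∃ L₀ : ℝ, 0 < L₀ ∧ ∀ L : ℝ, L₀ ≤ L → Set.InjOn (FreeScalar.proj d L) U) ∧
    ∀ L : ℝ, 0 < L → ∀ hL : Set.InjOn (FreeScalar.proj d L) U,
      ∃ hT : Function.Bijective (BVSym.unitH0 (FreeScalar.bvTorus m d L)),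
        FreeScalar.augState m d ∘ₗ FreeScalar.extendH0 m U = FreeScalar.cptfState m hL hT :=
  ⟨FreeScalar.exists_injOn_proj hU, fun _ hL0 hL =>
    ⟨BVSym.unitH0_bijective (FreeScalar.bvTorus_surjective hm hL0),
      FreeScalar.augState_comp_extendH0_eq_cptfState m hL _⟩⟩
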